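/- Let $n\ge 2$ and let $\mathcal G$ be a directed graph on $\{1,\dots,n\}$ that contains a directed spanning tree. Let $[a_{ij}]$ be a weighted adjacency matrix of $\mathcal G$ ($a_{ii}=0$ and, for $i\ne j$, $a_{ij}>0$ if $(j,i)$ is an edge and $a_{ij}=0$ otherwise), and let $L$ be its Laplacian, $L_{ii}=\sum_{j\ne i}a_{ij}$, $L_{ij}=-a_{ij}$ for $i\neq j$, with $i$-th row $L_i$. Let $r\in\mathbb R^n$ satisfy $r^{\mathsf T}L=0$ and $r^{\mathsf T}\mathbf 1=1$, let $W\in\mathbb R^{(n-1)\times n}$ and $U\in\mathbb R^{n\times(n-1)}$ be such that $\begin{bmatrix} r^{\mathsf T}\\ W\end{bmatrix}$ is invertible with inverse $\begin{bmatrix}\mathbf 1 & U\end{bmatrix}$, and put $J=WLU$. Let $\alpha_1,\alpha_2\in\mathbb R$ and let $\gamma_1,\gamma_2\in\mathbb R$ be such that $$\bar A=\begin{bmatrix}0&I\\ \alpha_1I-\gamma_1J&\alpha_2I-\gamma_2J\end{bmatrix}$$ is Hurwitz (all its eigenvalues have negative real part). For each $i$ let $m_i\ge 0$ be an integer, $\zeta_i:\mathbb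 R\to\mathbb R^{1\times m_i}$ a bounded function, $w_i\in\mathbb R^{m_i}$ a constant vector, $\lambda_i>0$, and let $\rho_i:\mathbb R\to\mathbb R^{m_i}$ be any continuously differentiable function with $\rho_i'(y)=-\lambda_i\zeta_i(y)^{\mathsf T}$ for all $y\in\mathbb R$. Consider the agents $$\dot p_i=v_i,\qquad \dot v_i=\alpha_1p_i+\alpha_2v_i+\zeta_i(v_i)w_i+u_i,\qquad i=1,\dots,n,$$ with the distributed controller $u_i=-\gamma_1L_ip-\gamma_2L_iv-\zeta_i(v_i)\mu_i$, where $$\mu_i=\hat w_i-\rho_i(v_i),\qquad \dot{\hat w}_i=-\lambda_i\zeta_i(v_i)^{\mathsf T}\,[\alpha_1p_i+\alpha_2v_i-\gamma_1L_ip-\gamma_2L_iv].$$ Then every solution $(p,v,\hat w)$ of the closed-loop system on $[0,\infty)$ achieves consensus: there are functions $p_o,v_o:[0,\infty)\to\mathbb R$ such that $$\lim_{t\to\infty}\bigl(p(t)-p_o(t)\mathbf 1\bigr)=0,\qquad \lim_{t\to\infty}\bigl(v(t)-v_o(t)\mathbf 1\bigr)=0.$$ -/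

import Mathlib

open Filter Set
open scoped Topology Matrix

namespace MAS

/-- `T` is a directed spanning tree of `G` with root `root`: a subgraph on all the nodes in which the
root has no parent, every other node has exactly one parent, and every node can be reached from
the root along directed edges. -/
structure IsDirectedSpanningTree {V : Type*} (G T : Digraph V) (root : V) : Prop where
  le : ∀ j i, T.Adj j i → G.Adj j i
  root_no_parent : ∀ j, ¬ T.Adj j root
  unique_parent : ∀ i, i ≠ root → ∃! j, T.Adj j i
  reachable : ∀ i, Relation.ReflTransGen T.Adj root i

/-- The directed graph `G` has a directed spanning tree. -/
def HasDirectedSpanningTree {V : Type*} (G : Digraph V) : Prop :=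
  ∃ (T : Digraph V) (root : V), IsDirectedSpanningTree G T root

/-- `a` is a weighted adjacency matrix of `G`: zero diagonal, and for `i ≠ j` the entry `a i j` is
positive if `(j, i)` is an edge (agent `i` receives information from agent `j`), else zero. -/
structure IsAdjacencyMatrix {n : ℕ} (G : Digraph (Fin n)) (a : Matrix (Fin n) (Fin n) ℝ) :
    Prop where
  diag : ∀ i, a i i = 0
  pos : ∀ i j, i ≠ j → G.Adj j i → 0 < a i j
  zero : ∀ i j, i ≠ j → ¬ G.Adj j i → a i j = 0

/-- The Laplacian of a weighted adjacency matrix. -/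
def laplacian {n : ℕ} (a : Matrix (Fin n) (Fin n) ℝ) : Matrix (Fin n) (Fin n) ℝ :=
  Matrix.of fun i j => if i = j then ∑ k ∈ Finset.univ.erase i, a i k else - a i j

/-- `r` is the left zero eigenvector of `L` with `rᵀ 1 = 1`, and `T = [rᵀ; W]` is invertible with
inverse `[1 U]`. -/
structure IsSplitting {n : ℕ} (L : Matrix (Fin n) (Fin n) ℝ) (r : Fin n → ℝ)
    (W : Matrix (Fin (n - 1)) (Fin n) ℝ) (U : Matrix (Fin n) (Fin (n - 1)) ℝ) : Prop where
  left_eigen : r ᵥ* L = 0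
  normalized : r ⬝ᵥ 1 = 1
  mul_inv : Matrix.fromRows (Matrix.replicateRow Unit r) W *
    Matrix.fromCols (Matrix.replicateCol Unit (1 : Fin n → ℝ)) U = 1
  inv_mul : Matrix.fromCols (Matrix.replicateCol Unit (1 : Fin n → ℝ)) U *
    Matrix.fromRows (Matrix.replicateRow Unit r) W = 1

/-- The matrix `[0, I; α₁ I - γ₁ J, α₂ I - γ₂ J]`. -/
def Abar {k : ℕ} (α₁ α₂ γ₁ γ₂ : ℝ) (J : Matrix (Fin k) (Fin k) ℝ) :
    Matrix (Fin k ⊕ Fin k) (Fin k ⊕ Fin k) ℝ :=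
  Matrix.fromBlocks 0 1
    (α₁ • (1 : Matrix (Fin k) (Fin k) ℝ) - γ₁ • J) (α₂ • (1 : Matrix (Fin k) (Fin k) ℝ) - γ₂ • J)

/-- A real square matrix is Hurwitz if all its complex eigenvalues have negative real part. -/
def IsHurwitz {ι : Type*} [Fintype ι] [DecidableEq ι] (M : Matrix ι ι ℝ) : Prop :=
  ∀ z ∈ spectrum ℂ (M.map (fun x : ℝ => (x : ℂ))), z.re < 0

/-- The open-loop agents on `[0, ∞)` with inputs `u i`:
`p_i' = v_i`, `v_i' = α₁ p_i + α₂ v_i + ζ_i(v_i) w_i + u_i`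
(`ζ i` has row vectors as values, so `ζ_i(v_i) w_i` is a dot product). -/
def AgentDynamics {n : ℕ} {m : Fin n → ℕ} (α₁ α₂ : ℝ)
    (ζ : (i : Fin n) → ℝ → Fin (m i) → ℝ) (w : (i : Fin n) → Fin (m i) → ℝ)
    (p v u : ℝ → Fin n → ℝ) : Prop :=
  ∀ i, ∀ t : ℝ, 0 ≤ t →
    HasDerivWithinAt (fun s => p s i) (v t i) (Ici 0) t ∧
    HasDerivWithinAt (fun s => v s i)
      (α₁ * p t i + α₂ * v t i + ζ i (v t i) ⬝ᵥ w i + u t i) (Ici 0) t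

/-- The adaptive input `μ_i = ŵ_i - ρ_i(v_i)`. -/
def adaptiveInput {n : ℕ} {m : Fin n → ℕ} (ρ : (i : Fin n) → ℝ → Fin (m i) → ℝ)
    (v : ℝ → Fin n → ℝ) (what : (i : Fin n) → ℝ → Fin (m i) → ℝ) (i : Fin n) (t : ℝ) :
    Fin (m i) → ℝ :=
  what i t - ρ i (v t i)

/-- The controller `u_i = - γ₁ L_i p - γ₂ L_i v - ζ_i(v_i) μ_i`. -/
def controller {n : ℕ} {m : Fin n → ℕ} (γ₁ γ₂ : ℝ) (L : Matrix (Fin n) (Fin n) ℝ)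
    (ζ : (i : Fin n) → ℝ → Fin (m i) → ℝ) (p v : ℝ → Fin n → ℝ)
    (μ : (i : Fin n) → ℝ → Fin (m i) → ℝ) : ℝ → Fin n → ℝ :=
  fun t i => - γ₁ * (L *ᵥ p t) i - γ₂ * (L *ᵥ v t) i - ζ i (v t i) ⬝ᵥ μ i t

/-- The update law `ŵ_i' = - λ_i ζ_i(v_i)ᵀ [α₁ p_i + α₂ v_i - γ₁ L_i p - γ₂ L_i v]` on `[0, ∞)`. -/
def UpdateLaw {n : ℕ} {m : Fin n → ℕ} (α₁ α₂ γ₁ γ₂ : ℝ) (L : Matrix (Fin n) (Fin n) ℝ)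
    (lam : Fin n → ℝ) (ζ : (i : Fin n) → ℝ → Fin (m i) → ℝ) (p v : ℝ → Fin n → ℝ)
    (what : (i : Fin n) → ℝ → Fin (m i) → ℝ) : Prop :=
  ∀ i, ∀ t : ℝ, 0 ≤ t →
    HasDerivWithinAt (what i)
      (-(lam i * (α₁ * p t i + α₂ * v t i - γ₁ * (L *ᵥ p t) i - γ₂ * (L *ᵥ v t) i)) •
        ζ i (v t i)) (Ici 0) t

end MAS

/-! The estimation error `e_i = w_i - ŵ_i + ρ_i(v_i)` obeys `e_i' = -λ_i ζ_iᵀ ζ_i e_i`: the term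
`ρ_i(v_i)` is designed so that its derivative along `v_i'` cancels the update law and leaves only
the unmodelled part `ζ_i e_i` of `v_i'`. Hence `|e_i|²/(2λ_i)` decreases at rate `(ζ_i e_i)²`, and
`g_i = ζ_i e_i` has finite energy (`hasFiniteEnergy_of_gradient_flow`). Since `L 1 = 0`, the
disagreement `(W p, W v)` satisfies a linear system with matrix `Abar`, driven by `(0, W g)`. A
Hurwitz system with finite-energy input has a state tending to zero (`MAS.IsHurwitz.tendsto_zero`),
and `x - (rᵀx) 1 = U W x` turns this into consensus. -/

open Polynomial in
theorem Matrix.aeval_prod_charpoly_roots {ι : Type*} [Fintype ι] [DecidableEq ι]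
    (A : Matrix ι ι ℂ) : aeval A (A.charpoly.roots.map fun c => X - C c).prod = 0 := by
  have h := (IsAlgClosed.splits A.charpoly).eq_prod_roots_of_monic A.charpoly_monic
  rw [← h, A.aeval_self_charpoly]

/-! ### Finite-energy signals -/

/-- A function has finite energy on `[0, ∞)` if its squared norm is at most the derivative of a
function that is bounded above. -/
def HasFiniteEnergy {E : Type*} [NormedAddCommGroup E] (f : ℝ → E) : Prop :=
  ∃ (F F' : ℝ → ℝ) (B : ℝ), ∀ t : ℝ, 0 ≤ t →
    HasDerivWithinAt F (F' t) (Ici 0) t ∧ ‖f t‖ ^ 2 ≤ F' t ∧ F t ≤ B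

namespace HasFiniteEnergy

variable {E E' : Type*} [NormedAddCommGroup E] [NormedAddCommGroup E']

theorem mono_mul {f : ℝ → E} {g : ℝ → E'} (hf : HasFiniteEnergy f) (c : ℝ)
    (hg : ∀ t : ℝ, 0 ≤ t → ‖g t‖ ≤ c * ‖f t‖) : HasFiniteEnergy g := by
  obtain ⟨F, F', B, h⟩ := hf
  refine ⟨fun t => c ^ 2 * F t, fun t => c ^ 2 * F' t, c ^ 2 * B, fun t ht => ?_⟩
  obtain ⟨h1, h2, h3⟩ := h t ht
  refine ⟨h1.const_mul _, ?_, mul_le_mul_of_nonneg_left h3 (sq_nonneg c)⟩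
  calc ‖g t‖ ^ 2 ≤ (c * ‖f t‖) ^ 2 := by gcongr; exact hg t ht
    _ = c ^ 2 * ‖f t‖ ^ 2 := by ring
    _ ≤ c ^ 2 * F' t := by gcongr

theorem zero : HasFiniteEnergy (fun _ : ℝ => (0 : E)) :=
  ⟨fun _ => 0, fun _ => 0, 0, fun _ _ => ⟨hasDerivWithinAt_const _ _ _, by simp, le_rfl⟩⟩

theorem add {f g : ℝ → E} (hf : HasFiniteEnergy f) (hg : HasFiniteEnergy g) :
    HasFiniteEnergy (fun t => f t + g t) := by
  obtain ⟨F, F', B, hF⟩ := hf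
  obtain ⟨G, G', C, hG⟩ := hg
  refine ⟨fun t => 2 * (F t + G t), fun t => 2 * (F' t + G' t), 2 * (B + C), fun t ht => ?_⟩
  obtain ⟨h1, h2, h3⟩ := hF t ht
  obtain ⟨k1, k2, k3⟩ := hG t ht
  refine ⟨(h1.add k1).const_mul 2, ?_, by linarith⟩
  have h4 : ‖f t + g t‖ ^ 2 ≤ (‖f t‖ + ‖g t‖) ^ 2 := by gcongr; exact norm_add_le _ _
  nlinarith [sq_nonneg (‖f t‖ - ‖g t‖)]

theorem sum {κ : Type*} (s : Finset κ) {f : κ → ℝ → E} (hf : ∀ k, HasFiniteEnergy (f k)) :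
    HasFiniteEnergy (fun t => ∑ k ∈ s, f k t) := by
  classical
  induction s using Finset.induction_on with
  | empty => simpa using zero
  | insert k s hk ih => simpa [Finset.sum_insert hk] using (hf k).add ih

theorem mulVec {𝕜 ι κ : Type*} [RCLike 𝕜] [Fintype κ] (M : Matrix ι κ 𝕜) {f : ℝ → κ → 𝕜}
    (hf : ∀ k, HasFiniteEnergy (fun t => f t k)) (i : ι) :
    HasFiniteEnergy (fun t => (M *ᵥ f t) i) :=
  HasFiniteEnergy.sum _ fun k => (hf k).mono_mul ‖M i k‖ fun _ _ => (norm_mul _ _).le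

end HasFiniteEnergy

theorem monotoneOn_Ici_of_hasDerivWithinAt_nonneg {F F' : ℝ → ℝ} {a : ℝ}
    (hF : ∀ t, a ≤ t → HasDerivWithinAt F (F' t) (Ici a) t) (h0 : ∀ t, a ≤ t → 0 ≤ F' t) :
    MonotoneOn F (Ici a) := by
  refine monotoneOn_of_hasDerivWithinAt_nonneg (f' := F') (convex_Ici a)
    (fun t ht => (hF t ht).continuousWithinAt) (fun t ht => ?_) fun t ht => ?_
  · exact (hF t (interior_subset ht)).mono interior_subset
  · exact h0 t (interior_subset ht)

theorem MonotoneOn.exists_tendsto_atTop {F : ℝ → ℝ} {a B : ℝ} (hF : MonotoneOn F (Ici a))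
    (hB : ∀ t, a ≤ t → F t ≤ B) : ∃ l, Tendsto F atTop (𝓝 l) := by
  have hm : Monotone fun t => F (max a t) := fun s t hst =>
    hF (mem_Ici.2 (le_max_left _ _)) (mem_Ici.2 (le_max_left _ _)) (max_le_max le_rfl hst)
  refine ⟨_, (tendsto_atTop_ciSup hm ⟨B, ?_⟩).congr' ?_⟩
  · rintro _ ⟨t, rfl⟩
    exact hB _ (le_max_left _ _)
  · filter_upwards [eventually_ge_atTop a] with t ht
    rw [max_eq_right ht]

/-- A stable scalar linear equation driven by an input of finite energy has a solution of finite
energy that tends to zero. -/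
theorem stable_scalar_of_hasFiniteEnergy {c : ℂ} (hc : c.re < 0) {z f : ℝ → ℂ}
    (hf : HasFiniteEnergy f)
    (hz : ∀ t : ℝ, 0 ≤ t → HasDerivWithinAt z (c * z t + f t) (Ici 0) t) :
    HasFiniteEnergy z ∧ Tendsto z atTop (𝓝 0) := by
  obtain ⟨F, F', B, hF⟩ := hf
  obtain ⟨d, hd, hcd⟩ : ∃ d : ℝ, 0 < d ∧ c.re = -d := ⟨-c.re, by linarith, by ring⟩
  -- Young's inequality gives `(‖z‖²)' ≤ -d‖z‖² + d⁻¹‖f‖²`; solving for `‖z‖²` yields this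
  -- primitive.
  have hG : ∀ t : ℝ, 0 ≤ t → HasDerivWithinAt (fun s => d⁻¹ * (d⁻¹ * F s - ‖z s‖ ^ 2))
      (d⁻¹ * (d⁻¹ * F' t - 2 * inner ℝ (z t) (c * z t + f t))) (Ici 0) t := fun t ht =>
    (((hF t ht).1.const_mul _).sub (hz t ht).norm_sq).const_mul _
  have hG' : ∀ t : ℝ, 0 ≤ t →
      ‖z t‖ ^ 2 ≤ d⁻¹ * (d⁻¹ * F' t - 2 * inner ℝ (z t) (c * z t + f t)) := by
    intro t ht
    have h1 : inner ℝ (z t) (c * z t + f t) ≤ -d * ‖z t‖ ^ 2 + ‖z t‖ * ‖f t‖ := by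
      have h2 : inner ℝ (z t) (c * z t) = -d * ‖z t‖ ^ 2 := by
        rw [← hcd, Complex.sq_norm, Complex.normSq_apply, Complex.inner]
        simp only [Complex.mul_re, Complex.mul_im, Complex.conj_re, Complex.conj_im]
        ring
      rw [inner_add_right, h2]
      gcongr
      exact real_inner_le_norm _ _
    have h3 := (hF t ht).2.1
    have h4 : 2 * (‖z t‖ * ‖f t‖) ≤ d * ‖z t‖ ^ 2 + d⁻¹ * ‖f t‖ ^ 2 := by
      have h5 : 0 ≤ d⁻¹ * (d * ‖z t‖ - ‖f t‖) ^ 2 := by positivity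
      have h6 : d⁻¹ * (d * ‖z t‖ - ‖f t‖) ^ 2 =
          d * ‖z t‖ ^ 2 + d⁻¹ * ‖f t‖ ^ 2 - 2 * (‖z t‖ * ‖f t‖) := by
        field_simp
        ring
      linarith
    have h7 : d⁻¹ * ‖f t‖ ^ 2 ≤ d⁻¹ * F' t := by gcongr
    rw [le_inv_mul_iff₀ hd]
    linarith
  have hGB : ∀ t : ℝ, 0 ≤ t → d⁻¹ * (d⁻¹ * F t - ‖z t‖ ^ 2) ≤ d⁻¹ * (d⁻¹ * B) := by
    intro t ht
    have := (hF t ht).2.2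
    gcongr
    have h8 : d⁻¹ * F t ≤ d⁻¹ * B := by gcongr
    linarith [sq_nonneg ‖z t‖]
  refine ⟨⟨_, _, _, fun t ht => ⟨hG t ht, hG' t ht, hGB t ht⟩⟩, ?_⟩
  obtain ⟨k, hk⟩ := (monotoneOn_Ici_of_hasDerivWithinAt_nonneg hG
    fun t ht => (sq_nonneg _).trans (hG' t ht)).exists_tendsto_atTop hGB
  obtain ⟨l, hl⟩ := (monotoneOn_Ici_of_hasDerivWithinAt_nonneg (fun t ht => (hF t ht).1)
    fun t ht => (sq_nonneg _).trans (hF t ht).2.1).exists_tendsto_atTop fun t ht => (hF t ht).2.2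
  -- `‖z‖²` is a combination of two bounded monotone functions, so it converges.
  have hlim : Tendsto (fun t => ‖z t‖ ^ 2) atTop (𝓝 (d⁻¹ * l - d * k)) := by
    refine ((hl.const_mul d⁻¹).sub (hk.const_mul d)).congr fun t => ?_
    field_simp
    ring
  have hnonneg : 0 ≤ d⁻¹ * l - d * k := ge_of_tendsto' hlim fun t => sq_nonneg _
  -- A positive limit `e` would make the bounded primitive grow at rate at least `e / 2` eventually.
  have hzero : d⁻¹ * l - d * k = 0 := by
    by_contra hne
    have hpos := lt_of_le_of_ne hnonneg (Ne.symm hne)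
    set e := d⁻¹ * l - d * k
    obtain ⟨T, hT⟩ := eventually_atTop.1 (hlim.eventually (lt_mem_nhds (half_lt_self hpos)))
    set S := max T 0
    have hS : ∀ t, S ≤ t → 0 ≤ t := fun t ht => (le_max_right _ _).trans ht
    have hmono := monotoneOn_Ici_of_hasDerivWithinAt_nonneg (a := S)
      (fun t ht => ((hG t (hS t ht)).mono (Ici_subset_Ici.2 (le_max_right _ _))).sub
        ((hasDerivWithinAt_id t (Ici S)).const_mul (e / 2)))
      (fun t ht => by
        have h1 := hG' t (hS t ht)
        have h2 := hT t ((le_max_left _ _).trans ht)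
        linarith)
    obtain ⟨b, hb⟩ : ∃ b, ∀ t, S ≤ t → t * (e / 2) ≤ b := by
      refine ⟨d⁻¹ * (d⁻¹ * B) - (d⁻¹ * (d⁻¹ * F S - ‖z S‖ ^ 2) - e / 2 * S), fun t ht => ?_⟩
      have h1 := hmono (mem_Ici.2 le_rfl) (mem_Ici.2 ht) ht
      have h2 := hGB t (hS t ht)
      simp only [Pi.sub_apply, id] at h1
      linarith
    obtain ⟨t, ht, ht'⟩ := ((eventually_ge_atTop S).and
      ((tendsto_id.atTop_mul_const (half_pos hpos)).eventually_gt_atTop b)).exists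
    exact absurd (hb t ht) (not_le.2 ht')
  rw [hzero] at hlim
  rw [tendsto_zero_iff_norm_tendsto_zero]
  simpa [Real.sqrt_sq] using hlim.sqrt

/-! ### Hurwitz linear systems -/

theorem HasDerivWithinAt.matrix_mulVec {𝕜 ι κ : Type*} [RCLike 𝕜] [Fintype κ] (M : Matrix ι κ 𝕜)
    {z : ℝ → κ → 𝕜} {z' : κ → 𝕜} {s : Set ℝ} {t : ℝ}
    (hz : ∀ k, HasDerivWithinAt (fun s => z s k) (z' k) s t) (i : ι) :
    HasDerivWithinAt (fun s => (M *ᵥ z s) i) ((M *ᵥ z') i) s t :=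
  HasDerivWithinAt.fun_sum fun k _ => (hz k).const_mul (M i k)

-- Peeling off one root `c` at a time avoids the Jordan form. The signal `y = (A - c) z` solves the
-- same system with input `(A - c) f` and is annihilated by the remaining factors; then each
-- coordinate solves the scalar equation `z_i' = c z_i + (y_i + f_i)`. Cayley–Hamilton provides the
-- annihilating product.
open Polynomial in
theorem stable_of_hasFiniteEnergy_of_aeval {ι : Type*} [Fintype ι] [DecidableEq ι]
    (A : Matrix ι ι ℂ) (s : Multiset ℂ) (hs : ∀ c ∈ s, c.re < 0) {z f : ℝ → ι → ℂ}
    (hf : ∀ i, HasFiniteEnergy (fun t => f t i))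
    (hz : ∀ i, ∀ t : ℝ, 0 ≤ t →
      HasDerivWithinAt (fun s => z s i) ((A *ᵥ z t + f t) i) (Ici 0) t)
    (h0 : ∀ t, aeval A (s.map fun c => X - C c).prod *ᵥ z t = 0) (i : ι) :
    HasFiniteEnergy (fun t => z t i) ∧ Tendsto (fun t => z t i) atTop (𝓝 0) := by
  induction s using Multiset.induction_on generalizing z f i with
  | empty =>
    -- The empty product is the identity matrix.
    have hz0 : ∀ t, z t = 0 := by simpa using h0
    simpa [hz0] using HasFiniteEnergy.zero
  | cons c s ih =>
    set M := A - algebraMap ℂ (Matrix ι ι ℂ) c with hM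
    have hcomm : M * A = A * M := by
      rw [hM, sub_mul, mul_sub, Algebra.commutes c A]
    have hMz : ∀ t, M *ᵥ z t = A *ᵥ z t - c • z t := fun t => by
      rw [hM, Matrix.sub_mulVec, Algebra.algebraMap_eq_smul_one, Matrix.smul_mulVec,
        Matrix.one_mulVec]
    have hy := ih (fun c hc => hs c (Multiset.mem_cons_of_mem hc))
      (z := fun t => M *ᵥ z t) (f := fun t => M *ᵥ f t) (HasFiniteEnergy.mulVec M hf)
      (fun i t ht => by
        have h := HasDerivWithinAt.matrix_mulVec M (fun k => hz k t ht) i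
        rwa [Matrix.mulVec_add, Matrix.mulVec_mulVec, hcomm, ← Matrix.mulVec_mulVec] at h)
      (fun t => by
        have h := h0 t
        rw [Multiset.map_cons, Multiset.prod_cons, mul_comm, map_mul, map_sub, aeval_X, aeval_C,
          ← Matrix.mulVec_mulVec] at h
        exact h)
    refine stable_scalar_of_hasFiniteEnergy (hs c (Multiset.mem_cons_self c s))
      ((hy i).1.add (hf i)) fun t ht => (hz i t ht).congr_deriv ?_
    simp only [hMz, Pi.add_apply, Pi.sub_apply, Pi.smul_apply, smul_eq_mul]
    ring

theorem MAS.IsHurwitz.tendsto_zero {ι : Type*} [Fintype ι] [DecidableEq ι]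
    {A : Matrix ι ι ℝ} (hA : MAS.IsHurwitz A) {z f : ℝ → ι → ℝ}
    (hf : ∀ i, HasFiniteEnergy (fun t => f t i))
    (hz : ∀ i, ∀ t : ℝ, 0 ≤ t →
      HasDerivWithinAt (fun s => z s i) ((A *ᵥ z t + f t) i) (Ici 0) t) (i : ι) :
    Tendsto (fun t => z t i) atTop (𝓝 0) := by
  set Ac := A.map (fun x : ℝ => (x : ℂ)) with hAc
  have h := (stable_of_hasFiniteEnergy_of_aeval Ac Ac.charpoly.roots
    (fun c hc => hA c (Matrix.mem_spectrum_of_isRoot_charpoly (Polynomial.isRoot_of_mem_roots hc)))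
    (z := fun t k => (z t k : ℂ)) (f := fun t k => (f t k : ℂ))
    (fun k => (hf k).mono_mul 1 fun t _ => by simp)
    (fun k t ht => (hz k t ht).ofReal_comp.congr_deriv (by
      simp [hAc, Matrix.mulVec, dotProduct]))
    (fun t => by rw [Ac.aeval_prod_charpoly_roots, Matrix.zero_mulVec]) i).2
  simpa [Function.comp_def] using (Complex.continuous_re.tendsto 0).comp h

/-! ### Splitting off the consensus direction -/

theorem MAS.laplacian_mulVec_one {n : ℕ} (a : Matrix (Fin n) (Fin n) ℝ) :
    MAS.laplacian a *ᵥ 1 = 0 := by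
  ext i
  simp only [Matrix.mulVec, dotProduct, Pi.one_apply, mul_one, Pi.zero_apply]
  rw [← Finset.add_sum_erase _ _ (Finset.mem_univ i)]
  have h : ∀ j ∈ Finset.univ.erase i, MAS.laplacian a i j = - a i j := fun j hj => by
    simp [MAS.laplacian, (Finset.ne_of_mem_erase hj).symm]
  rw [Finset.sum_congr rfl h]
  simp [MAS.laplacian]

/-- The product of the inverse pair reads `1 rᵀ + U W = I`. -/
theorem MAS.IsSplitting.eq_add {n : ℕ} {L : Matrix (Fin n) (Fin n) ℝ} {r : Fin n → ℝ}
    {W : Matrix (Fin (n - 1)) (Fin n) ℝ} {U : Matrix (Fin n) (Fin (n - 1)) ℝ}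
    (h : MAS.IsSplitting L r W U) (x : Fin n → ℝ) :
    x = (r ⬝ᵥ x) • (1 : Fin n → ℝ) + U *ᵥ (W *ᵥ x) := by
  have h1 := h.inv_mul
  rw [Matrix.fromCols_mul_fromRows] at h1
  conv_lhs => rw [← Matrix.one_mulVec x, ← h1, Matrix.add_mulVec, ← Matrix.mulVec_mulVec,
    ← Matrix.mulVec_mulVec]
  congr 1
  ext i
  simp [Matrix.mulVec, dotProduct]

theorem MAS.IsSplitting.mulVec_laplacian {n : ℕ} {a : Matrix (Fin n) (Fin n) ℝ} {r : Fin n → ℝ}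
    {W : Matrix (Fin (n - 1)) (Fin n) ℝ} {U : Matrix (Fin n) (Fin (n - 1)) ℝ}
    (h : MAS.IsSplitting (MAS.laplacian a) r W U) (x : Fin n → ℝ) :
    W *ᵥ (MAS.laplacian a *ᵥ x) = (W * MAS.laplacian a * U) *ᵥ (W *ᵥ x) := by
  conv_lhs => rw [h.eq_add x, Matrix.mulVec_add, Matrix.mulVec_smul, MAS.laplacian_mulVec_one,
    smul_zero, zero_add, Matrix.mulVec_mulVec, Matrix.mulVec_mulVec]

theorem MAS.IsSplitting.tendsto_sub {n : ℕ} {L : Matrix (Fin n) (Fin n) ℝ} {r : Fin n → ℝ}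
    {W : Matrix (Fin (n - 1)) (Fin n) ℝ} {U : Matrix (Fin n) (Fin (n - 1)) ℝ}
    (h : MAS.IsSplitting L r W U) {x : ℝ → Fin n → ℝ}
    (hx : ∀ i, Tendsto (fun t => (W *ᵥ x t) i) atTop (𝓝 0)) :
    Tendsto (fun t => x t - (r ⬝ᵥ x t) • (1 : Fin n → ℝ)) atTop (𝓝 0) := by
  have h1 : ∀ t, x t - (r ⬝ᵥ x t) • (1 : Fin n → ℝ) = U *ᵥ (W *ᵥ x t) := fun t =>
    sub_eq_iff_eq_add'.2 (h.eq_add (x t))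
  simp only [h1]
  have h2 := ((continuous_const (y := U)).matrix_mulVec continuous_id).tendsto
    (0 : Fin (n - 1) → ℝ) |>.comp (tendsto_pi_nhds.2 hx)
  simpa [Function.comp_def] using h2

/-! ### Estimation error and closed loop -/

/-- The energy identity for the estimation error `e' = -(λ ζᵀ ζ) e`. -/
theorem hasFiniteEnergy_of_gradient_flow {κ : Type*} [Fintype κ] {l : ℝ} (hl : 0 < l)
    {e φ : ℝ → κ → ℝ}
    (he : ∀ t : ℝ, 0 ≤ t → HasDerivWithinAt e (-(l * (φ t ⬝ᵥ e t)) • φ t) (Ici 0) t) :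
    HasFiniteEnergy (fun t => φ t ⬝ᵥ e t) := by
  -- The negated Lyapunov function `-|e|²/(2l)` is bounded above by `0`, with derivative exactly `(φ
  -- ⬝ᵥ e)²`.
  refine ⟨fun t => -(2 * l)⁻¹ * ∑ k, e t k ^ 2, fun t => (φ t ⬝ᵥ e t) ^ 2, 0, fun t ht => ⟨?_, ?_, ?_⟩⟩
  · refine ((HasDerivWithinAt.fun_sum fun k _ =>
      (hasDerivWithinAt_pi.1 (he t ht) k).pow 2).const_mul (-(2 * l)⁻¹)).congr_deriv ?_
    have h1 : ∑ k, ((2 : ℕ) : ℝ) * e t k ^ (2 - 1) * (-(l * (φ t ⬝ᵥ e t)) • φ t) k =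
        -(2 * l * (φ t ⬝ᵥ e t)) * (φ t ⬝ᵥ e t) := by
      conv_rhs => rw [dotProduct, Finset.mul_sum]
      refine Finset.sum_congr rfl fun k _ => ?_
      simp only [Pi.smul_apply, smul_eq_mul, dotProduct]
      push_cast
      ring
    rw [h1]
    field_simp
  · rw [Real.norm_eq_abs, sq_abs]
  · have h1 : 0 ≤ (2 * l)⁻¹ * ∑ k, e t k ^ 2 := by positivity
    linarith

theorem theorem3 {n : ℕ} (hn : 2 ≤ n)
    (G : Digraph (Fin n)) (a : Matrix (Fin n) (Fin n) ℝ) (ha : MAS.IsAdjacencyMatrix G a)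
    (hG : MAS.HasDirectedSpanningTree G)
    (r : Fin n → ℝ) (W : Matrix (Fin (n - 1)) (Fin n) ℝ) (U : Matrix (Fin n) (Fin (n - 1)) ℝ)
    (hsplit : MAS.IsSplitting (MAS.laplacian a) r W U)
    (α₁ α₂ γ₁ γ₂ : ℝ)
    (hγ : MAS.IsHurwitz (MAS.Abar α₁ α₂ γ₁ γ₂ (W * MAS.laplacian a * U)))
    (m : Fin n → ℕ)
    (ζ : (i : Fin n) → ℝ → Fin (m i) → ℝ) (hζ : ∀ i, ∃ C : ℝ, ∀ y : ℝ, ‖ζ i y‖ ≤ C)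
    (w : (i : Fin n) → Fin (m i) → ℝ)
    (lam : Fin n → ℝ) (hlam : ∀ i, 0 < lam i)
    (ρ : (i : Fin n) → ℝ → Fin (m i) → ℝ) (hρ : ∀ i, ContDiff ℝ 1 (ρ i))
    (hρ' : ∀ i, ∀ y : ℝ, HasDerivAt (ρ i) (-(lam i • ζ i y)) y)
    (p v : ℝ → Fin n → ℝ) (what : (i : Fin n) → ℝ → Fin (m i) → ℝ)
    (hagents : MAS.AgentDynamics α₁ α₂ ζ w p v
      (MAS.controller γ₁ γ₂ (MAS.laplacian a) ζ p v (MAS.adaptiveInput ρ v what)))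
    (hupdate : MAS.UpdateLaw α₁ α₂ γ₁ γ₂ (MAS.laplacian a) lam ζ p v what) :
    ∃ p_o v_o : ℝ → ℝ,
      Tendsto (fun t => p t - p_o t • (1 : Fin n → ℝ)) atTop (𝓝 0) ∧
      Tendsto (fun t => v t - v_o t • (1 : Fin n → ℝ)) atTop (𝓝 0) := by
  set L := MAS.laplacian a with hL
  set g : ℝ → Fin n → ℝ := fun t i => ζ i (v t i) ⬝ᵥ (w i - what i t + ρ i (v t i)) with hgdef
  have hv : ∀ i, ∀ t : ℝ, 0 ≤ t → HasDerivWithinAt (fun s => v s i)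
      ((α₁ • p t + α₂ • v t - γ₁ • (L *ᵥ p t) - γ₂ • (L *ᵥ v t) + g t) i) (Ici 0) t := by
    intro i t ht
    refine (hagents i t ht).2.congr_deriv ?_
    simp only [MAS.controller, MAS.adaptiveInput, hgdef, dotProduct_add, dotProduct_sub,
      Pi.add_apply, Pi.sub_apply, Pi.smul_apply, smul_eq_mul]
    ring
  have hg : ∀ i, HasFiniteEnergy (fun t => g t i) := by
    intro i
    refine hasFiniteEnergy_of_gradient_flow (hlam i) fun t ht => ?_
    -- By the chain rule the nominal part of `v_i'` cancels against the update law, leaving `-λ_i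
    -- g_i ζ_i`.
    refine (((hupdate i t ht).const_sub (w i)).add
      ((hρ' i (v t i)).scomp_hasDerivWithinAt_of_eq t (hv i t ht) rfl)).congr_deriv ?_
    ext k
    simp only [hgdef, Pi.add_apply, Pi.sub_apply, Pi.smul_apply, Pi.neg_apply, smul_eq_mul]
    ring
  have hWL : ∀ x, W *ᵥ (L *ᵥ x) = (W * L * U) *ᵥ (W *ᵥ x) := hsplit.mulVec_laplacian
  have hz := hγ.tendsto_zero (z := fun t => Sum.elim (W *ᵥ p t) (W *ᵥ v t))
    (f := fun t => Sum.elim 0 (W *ᵥ g t))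
    (by
      rintro (i | i)
      · exact HasFiniteEnergy.zero
      · exact HasFiniteEnergy.mulVec W hg i)
    (by
      rintro (i | i) t ht
      · refine (HasDerivWithinAt.matrix_mulVec W (fun k => (hagents k t ht).1) i).congr_deriv ?_
        simp [MAS.Abar, Matrix.fromBlocks_mulVec]
      · refine (HasDerivWithinAt.matrix_mulVec W (fun k => hv k t ht) i).congr_deriv ?_
        simp only [MAS.Abar, Matrix.fromBlocks_mulVec, Matrix.mulVec_add, Matrix.mulVec_sub,
          Matrix.mulVec_smul, hWL, Matrix.sub_mulVec, Matrix.smul_mulVec, Matrix.one_mulVec,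
          Pi.add_apply, Pi.sub_apply, Pi.smul_apply, smul_eq_mul, Sum.elim_inr, Sum.elim_inl,
          Function.comp_def]
        ring)
  exact ⟨fun t => r ⬝ᵥ p t, fun t => r ⬝ᵥ v t, hsplit.tendsto_sub fun i => hz (Sum.inl i),
    hsplit.tendsto_sub fun i => hz (Sum.inr i)⟩
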